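/- Let $\mathcal X$ and $\mathcal Y$ be complex Euclidean spaces (non-zero finite-dimensional complex inner product spaces, each with a fixed orthonormal standard basis), and write $L(\mathcal X)$ for the space of linear operators on $\mathcal X$. Let $\Phi_0,\Phi_1 : L(\mathcal X)\to L(\mathcal Y)$ be admissible super-operators, that is, linear maps that are trace-preserving and completely positive ($\Phi\otimes 1_{L(\mathcal Z)}$ maps positive semidefinite operators to positive semidefinite operators for every complex Euclidean space $\mathcal Z$). For a linear map $\Phi : L(\mathcal X)\to L(\mathcal Y)$ let $$J(\Phi)=\sum_{a,b}\Phi(|a\rangle\langle b|)\otimes|a\rangle\langle b|\in L(\mathcal Y\otimes\mathcal X)$$ be its Choi–Jamiołkowski representation, where $|a\rangle,|b\rangle$ range over the standard basis of $\mathcal X$; let $\|A\|_1=\operatorname{Tr}\sqrt{A^*A}$ be the trace norm of an operator, let $\|\Phi\|_1=\max\{\|\Phi(X)\|_1 : X\in L(\mathcal X),\ \|X\|_1\le 1\}$, and let $\|\Phi\|_\diamond=\|\Phi\otimes 1_{L(\mathcal X)}\|_1$ be the diamond norm. Put $k=\operatorname{rank} J(\Phi_0-\Phi_1)$. Then for every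 complex Euclidean space $\mathcal W\neq 0$ with $\dim\mathcal W\ge 2k$ there exists a unit vector $u\in\mathcal X\otimes\mathcal W$ such that $$\bigl\|(\Phi_0\otimes 1_{L(\mathcal W)})(uu^*)-(\Phi_1\otimes 1_{L(\mathcal W)})(uu^*)\bigr\|_1=\|\Phi_0-\Phi_1\|_\diamond .$$ -/

import Mathlib

open scoped Matrix Kronecker ComplexOrder MatrixOrder

/-!
A complex Euclidean space (with its fixed orthonormal standard basis) is `EuclideanSpace ℂ x` for a
finite non-empty index type `x`; operators on it are the matrices `Matrix x x ℂ`; the tensor product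
of the spaces indexed by `x` and `w` is the space indexed by `x × w`.
-/

namespace QuantumOp

noncomputable section

/-- Super-operators: linear maps from the operators on `ℂ^x` to the operators on `ℂ^y`. -/
abbrev SuperOp (x y : Type*) := Matrix x x ℂ →ₗ[ℂ] Matrix y y ℂ

/-- The trace norm `Tr √(A* A)` of an operator. -/
def traceNorm {m n : Type*} [Fintype m] [Fintype n] [DecidableEq n] (A : Matrix m n ℂ) : ℝ :=
  (CFC.sqrt (Aᴴ * A)).trace.re

/-- The super-operator `Φ ⊗ 1` on `ℂ^x ⊗ ℂ^z`: it applies `Φ` to each of the blocks (indexed by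
pairs of elements of `z`) of an operator. -/
def tensorId {x y : Type*} (Φ : SuperOp x y) (z : Type*) : SuperOp (x × z) (y × z) where
  toFun M := Matrix.of fun p q => Φ (Matrix.of fun i j => M (i, p.2) (j, q.2)) p.1 q.1
  map_add' M N := by
    ext p q
    exact congrFun (congrFun (map_add Φ (Matrix.of fun i j => M (i, p.2) (j, q.2))
      (Matrix.of fun i j => N (i, p.2) (j, q.2))) p.1) q.1
  map_smul' c M := by
    ext p q
    exact congrFun (congrFun (map_smul Φ c (Matrix.of fun i j => M (i, p.2) (j, q.2))) p.1) q.1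

/-- The defining property of `Φ ⊗ 1`: it maps `A ⊗ B` to `Φ A ⊗ B`. -/
theorem tensorId_kronecker {x y z : Type*} (Φ : SuperOp x y) (A : Matrix x x ℂ)
    (B : Matrix z z ℂ) : tensorId Φ z (A ⊗ₖ B) = Φ A ⊗ₖ B := by
  ext p q
  have h : (Matrix.of fun i j => (A ⊗ₖ B) (i, p.2) (j, q.2)) = B p.2 q.2 • A := by
    ext i j
    simp [Matrix.kroneckerMap_apply, mul_comm]
  simp only [tensorId, LinearMap.coe_mk, AddHom.coe_mk, Matrix.of_apply]
  rw [h, map_smul]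
  simp [Matrix.kroneckerMap_apply, mul_comm]

/-- A positive super-operator maps positive semidefinite operators to such operators. -/
def IsPositive {x y : Type*} (Φ : SuperOp x y) : Prop :=
  ∀ P : Matrix x x ℂ, P.PosSemidef → (Φ P).PosSemidef

/-- `Φ` is completely positive if `Φ ⊗ 1` is positive for every auxiliary space. -/
def IsCompletelyPositive {x y : Type*} (Φ : SuperOp x y) : Prop :=
  ∀ m : ℕ, IsPositive (tensorId Φ (Fin m))

/-- `Φ` preserves the trace. -/
def IsTracePreserving {x y : Type*} [Fintype x] [Fintype y] (Φ : SuperOp x y) : Prop :=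
  ∀ A : Matrix x x ℂ, (Φ A).trace = A.trace

/-- Admissible super-operators: completely positive and trace-preserving. -/
def IsAdmissible {x y : Type*} [Fintype x] [Fintype y] (Φ : SuperOp x y) : Prop :=
  IsCompletelyPositive Φ ∧ IsTracePreserving Φ

/-- The Choi-Jamiołkowski representation `J(Φ) = ∑_{a,b} Φ(|a⟩⟨b|) ⊗ |a⟩⟨b|`. -/
def choi {x y : Type*} [Fintype x] [DecidableEq x] (Φ : SuperOp x y) :
    Matrix (y × x) (y × x) ℂ :=
  ∑ a : x, ∑ b : x, Φ (Matrix.single a b 1) ⊗ₖ Matrix.single a b (1 : ℂ)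

/-- The super-operator trace norm: the maximum of `‖Φ(A)‖₁` over all `A` with `‖A‖₁ ≤ 1`. -/
def superTraceNorm {x y : Type*} [Fintype x] [DecidableEq x] [Fintype y] [DecidableEq y]
    (Φ : SuperOp x y) : ℝ :=
  sSup {r : ℝ | ∃ A : Matrix x x ℂ, traceNorm A ≤ 1 ∧ r = traceNorm (Φ A)}

/-- The diamond norm: the super-operator trace norm of `Φ ⊗ 1`, where `1` is the identity
super-operator on the operators on the input space. -/
def diamondNorm {x y : Type*} [Fintype x] [DecidableEq x] [Fintype y] [DecidableEq y]
    (Φ : SuperOp x y) : ℝ :=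
  superTraceNorm (tensorId Φ x)

/-- The rank-one operator `u u*`. -/
def outer {n : Type*} (u : EuclideanSpace ℂ n) : Matrix n n ℂ :=
  Matrix.vecMulVec u.ofLp (star u.ofLp)

end

end QuantumOp

/-!
Let `Φ = Φ₀ - Φ₁`, with Choi matrix `P * Qᴴ` where `P` and `Q` have `k = rank` columns. A vector `u` of
`ℂ^x ⊗ ℂ^z` is a matrix `V`, and `(Φ ⊗ 1)(u u*) = ((1 ⊗ V) P) ((1 ⊗ V) Q)ᴴ`. The trace norm of a
product `K * Lᴴ` depends only on `Kᴴ * K` and `Lᴴ * L` (`traceNorm_mul_conjTranspose`), here two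
`k × k` matrices that are linear in `Vᴴ * V`, the reduced state up to transposition. Thus the trace norm of the output, and
the norm of `u`, are determined by `2 k ^ 2 + 1` linear functionals of the reduced state.

A positive operator of rank `r` with `r ^ 2 > 2 k ^ 2 + 1` can be moved, within its face of the positive
cone and without changing these functionals, to the boundary of the face, where the rank is smaller
(`exists_conjTranspose_mul_self_of_finrank_lt`). So the rank can be lowered to `max 1 (2 k)`, and every
pure input with any auxiliary space can be replaced by one with the auxiliary space `ℂ^w`
(`exists_vec_of_two_mul_rank_le`). Writing `Vᴴ * V = Rᴴ * R` with `R` square, it can likewise be replaced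
by one with the auxiliary space `ℂ^x` of the diamond norm (`exists_vec_input_space`).

It remains to compare general operators on `ℂ^x ⊗ ℂ^x` with pure states. Since `Φ` preserves adjoints,
an operator `A` does no better than `u u*` for some `u` with `‖u‖ ^ 2 = ‖A‖₁` and a larger auxiliary space
(`exists_vec_traceNorm_tensorId_le`), which may then be cut down to `ℂ^w`. The optimal `u` exists by
compactness of the unit sphere (`exists_norm_eq_one_isMaxOn`).
-/

namespace QuantumOp

open Matrix

/-! ### The trace norm: polar decomposition, spectral formula and duality -/

theorem exists_diagonal_eq_conjTranspose_mul_self {m n : Type*} [Fintype m] [Fintype n]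
    [DecidableEq n] (A : Matrix m n ℂ) :
    ∃ (Q : Matrix n n ℂ) (d : n → ℝ), Qᴴ * Q = 1 ∧ (∀ i, 0 ≤ d i) ∧
      Aᴴ * A = Q * diagonal (fun i => ((d i * d i : ℝ) : ℂ)) * Qᴴ := by
  have hA := isHermitian_conjTranspose_mul_self A
  have hpos := posSemidef_conjTranspose_mul_self A
  refine ⟨hA.eigenvectorUnitary, fun i => √(hA.eigenvalues i),
    Unitary.coe_star_mul_self _, fun i => Real.sqrt_nonneg _, ?_⟩
  have h := hA.spectral_theorem
  rw [Unitary.conjStarAlgAut_apply] at h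
  simp_rw [Real.mul_self_sqrt (hpos.eigenvalues_nonneg _)]
  exact h

/-- Polar decomposition `A = P * S` with `S = √(Aᴴ * A)`. The factor `P` is only a contraction: it is
the partial isometry that vanishes on the kernel of `A`. -/
theorem exists_polar {m n : Type*} [Fintype m] [Fintype n] [DecidableEq n] (A : Matrix m n ℂ) :
    ∃ (P : Matrix m n ℂ) (S : Matrix n n ℂ), S.PosSemidef ∧ A = P * S ∧ Pᴴ * A = S ∧
      (1 - Pᴴ * P).PosSemidef ∧ S.trace = traceNorm A := by
  -- `T` is the pseudo-inverse of `S`, and `E = S * T` the projection onto the range of `S`.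
  obtain ⟨Q, d, hQ, hd, hA⟩ := exists_diagonal_eq_conjTranspose_mul_self A
  have mul3 : ∀ f g : n → ℂ, (Q * diagonal f * Qᴴ) * (Q * diagonal g * Qᴴ) =
      Q * diagonal (fun i => f i * g i) * Qᴴ := by
    intro f g
    calc _ = Q * diagonal f * (Qᴴ * Q) * diagonal g * Qᴴ := by simp only [Matrix.mul_assoc]
      _ = _ := by rw [hQ, Matrix.mul_one, Matrix.mul_assoc Q, diagonal_mul_diagonal]
  have herm : ∀ f : n → ℝ, (Q * diagonal (fun i => (f i : ℂ)) * Qᴴ)ᴴ =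
      Q * diagonal (fun i => (f i : ℂ)) * Qᴴ := by
    intro f
    rw [conjTranspose_mul, conjTranspose_mul, conjTranspose_conjTranspose,
      diagonal_conjTranspose, Matrix.mul_assoc]
    congr
    ext i
    simp
  have psd : ∀ f : n → ℝ, (∀ i, 0 ≤ f i) →
      (Q * diagonal (fun i => (f i : ℂ)) * Qᴴ).PosSemidef := by
    intro f hf
    exact (PosSemidef.diagonal (fun i => by simpa using hf i)).mul_mul_conjTranspose_same Q
  set S := Q * diagonal (fun i => (d i : ℂ)) * Qᴴ with hS
  set T := Q * diagonal (fun i => (((d i)⁻¹ : ℝ) : ℂ)) * Qᴴ with hT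
  set E := Q * diagonal (fun i => ((d i * (d i)⁻¹ : ℝ) : ℂ)) * Qᴴ with hE
  have hST : S * T = E := by rw [hS, hT, mul3, hE]; push_cast; rfl
  have hTS : T * S = E := by
    rw [hS, hT, mul3, hE]; push_cast; simp only [mul_comm]
  have hSS : S * S = Aᴴ * A := by rw [hS, mul3, hA]; push_cast; rfl
  have hES : E * S = S := by
    rw [hE, hS, mul3]
    congr; ext i
    by_cases h : d i = 0 <;> simp [h]
  have hTT : Tᴴ = T := herm _
  have hSH : Sᴴ = S := herm _
  have hEH : Eᴴ = E := herm _
  have hSE : S * E = S := by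
    have := congrArg conjTranspose hES
    rwa [conjTranspose_mul, hEH, hSH] at this
  have hEE : E * E = E := by
    rw [← hTS, Matrix.mul_assoc, ← Matrix.mul_assoc S T S, hST, hES]
  have hSpos : S.PosSemidef := psd _ hd
  refine ⟨A * T, S, hSpos, ?_, ?_, ?_, ?_⟩
  · -- `A` vanishes on the kernel of `Aᴴ * A`.
    have h0 : A * (1 - E) = 0 := by
      rw [← conjTranspose_mul_self_eq_zero, conjTranspose_mul, Matrix.mul_assoc,
        ← Matrix.mul_assoc Aᴴ, ← hSS, Matrix.mul_assoc S S, Matrix.mul_sub, hSE,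
        Matrix.mul_one, sub_self, Matrix.mul_zero, Matrix.mul_zero]
    rw [Matrix.mul_assoc, hTS]
    rw [Matrix.mul_sub, Matrix.mul_one, sub_eq_zero] at h0
    exact h0
  · rw [conjTranspose_mul, Matrix.mul_assoc, ← hSS, hTT, ← Matrix.mul_assoc, hTS, hES]
  · rw [conjTranspose_mul, Matrix.mul_assoc, ← Matrix.mul_assoc Aᴴ, ← hSS, hTT, Matrix.mul_assoc S,
      hST, hSE, hTS]
    have : (1 - E) = (1 - E)ᴴ * (1 - E) := by
      rw [conjTranspose_sub, conjTranspose_one, hEH, sub_mul, one_mul, mul_sub, hEE, mul_one, sub_self,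
        sub_zero]
    rw [this]
    exact posSemidef_conjTranspose_mul_self _
  · have hsq : CFC.sqrt (Aᴴ * A) = S := CFC.sqrt_unique hSS hSpos.nonneg
    rw [traceNorm, hsq]
    have := hSpos.trace_nonneg
    exact (Complex.eq_re_of_ofReal_le this : _)

/-- The trace norm is the sum of the singular values, read off from the characteristic polynomial of
`Aᴴ * A` so that it can be transported along `charpoly_mul_comm'`. -/
theorem traceNorm_eq_sum_roots {m n : Type*} [Fintype m] [Fintype n] [DecidableEq n]
    (A : Matrix m n ℂ) :
    traceNorm A = ((Aᴴ * A).charpoly.roots.map fun z : ℂ => √z.re).sum := by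
  have hA := isHermitian_conjTranspose_mul_self A
  have hpos := posSemidef_conjTranspose_mul_self A
  rw [traceNorm, CFC.sqrt_eq_real_sqrt _ hpos.nonneg, cfcₙ_eq_cfc, hA.cfc_eq, IsHermitian.cfc,
    Unitary.conjStarAlgAut_apply, Matrix.trace_mul_cycle, Unitary.coe_star_mul_self,
    Matrix.one_mul, hA.roots_charpoly_eq_eigenvalues]
  simp [Matrix.trace]

theorem traceNorm_nonneg {m n : Type*} [Fintype m] [Fintype n] [DecidableEq n]
    (A : Matrix m n ℂ) : 0 ≤ traceNorm A := by
  rw [traceNorm_eq_sum_roots]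
  refine Multiset.sum_nonneg fun r hr => ?_
  obtain ⟨z, -, rfl⟩ := Multiset.mem_map.mp hr
  exact Real.sqrt_nonneg _

/-- The products `A * B` and `B * A` have the same spectrum up to zeros, which do not contribute. -/
theorem sum_sqrt_roots_mul_comm {m n : Type*} [Fintype m] [Fintype n] [DecidableEq m]
    [DecidableEq n] (A : Matrix m n ℂ) (B : Matrix n m ℂ) :
    ((A * B).charpoly.roots.map fun z : ℂ => √z.re).sum =
      ((B * A).charpoly.roots.map fun z : ℂ => √z.re).sum := by
  have h := congrArg (fun p : Polynomial ℂ => (p.roots.map fun z : ℂ => √z.re).sum)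
    (charpoly_mul_comm' A B)
  beta_reduce at h
  rw [Polynomial.roots_mul, Polynomial.roots_mul] at h
  · simpa [Multiset.map_nsmul, Multiset.sum_nsmul] using h
  · exact mul_ne_zero (pow_ne_zero _ Polynomial.X_ne_zero) (charpoly_monic _).ne_zero
  · exact mul_ne_zero (pow_ne_zero _ Polynomial.X_ne_zero) (charpoly_monic _).ne_zero

/-- The trace norm of `K * Lᴴ` depends only on the Gram matrices of the columns of `K` and `L`. -/
theorem traceNorm_mul_conjTranspose {m k : Type*} [Fintype m] [Fintype k] [DecidableEq m]
    [DecidableEq k] (K L : Matrix m k ℂ) :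
    traceNorm (K * Lᴴ) =
      ((Kᴴ * K * (Lᴴ * L)).charpoly.roots.map fun z : ℂ => √z.re).sum := by
  rw [traceNorm_eq_sum_roots, conjTranspose_mul, conjTranspose_conjTranspose,
    Matrix.mul_assoc, sum_sqrt_roots_mul_comm]
  simp only [Matrix.mul_assoc]

/-- Every operator `A` is a product of two operators whose squared Hilbert-Schmidt norms are the trace
norm of `A`. -/
theorem exists_factorization {m n : Type*} [Fintype m] [Fintype n] [DecidableEq n]
    (A : Matrix m n ℂ) :
    ∃ (C : Matrix m n ℂ) (D : Matrix n n ℂ), A = C * Dᴴ ∧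
      (Cᴴ * C).trace = traceNorm A ∧ (Dᴴ * D).trace = traceNorm A := by
  obtain ⟨P, S, hS, hA, hPA, -, htr⟩ := exists_polar A
  obtain ⟨R, hR⟩ := CStarAlgebra.nonneg_iff_eq_star_mul_self.mp hS.nonneg
  rw [star_eq_conjTranspose] at hR
  refine ⟨P * Rᴴ, Rᴴ, ?_, ?_, ?_⟩
  · rw [conjTranspose_conjTranspose, Matrix.mul_assoc, ← hR, ← hA]
  · rw [conjTranspose_mul, conjTranspose_conjTranspose, Matrix.mul_assoc,
      Matrix.trace_mul_comm, Matrix.mul_assoc, Matrix.mul_assoc, ← hR, ← hA, hPA, htr]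
  · rw [conjTranspose_conjTranspose, Matrix.trace_mul_comm, ← hR, htr]

/-- One half of the duality between the trace norm and the operator norm; the other half is
`exists_contraction_trace_mul_eq`. -/
theorem re_trace_mul_le_traceNorm {m n : Type*} [Fintype m] [Fintype n] [DecidableEq m]
    [DecidableEq n] {W : Matrix n m ℂ} (hW : (1 - Wᴴ * W).PosSemidef) (A : Matrix m n ℂ) :
    (W * A).trace.re ≤ traceNorm A := by
  obtain ⟨C, D, hCD, h1, h2⟩ := exists_factorization A
  replace h1 := congrArg Complex.re h1
  replace h2 := congrArg Complex.re h2
  rw [Complex.ofReal_re] at h1 h2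
  -- `2 Re tr(W A) ≤ ‖W C‖² + ‖D‖²` in the Hilbert-Schmidt norm, and `‖W C‖ ≤ ‖C‖`.
  have h3 : 0 ≤ (Cᴴ * (1 - Wᴴ * W) * C).trace.re :=
    (Complex.nonneg_iff.mp (hW.conjTranspose_mul_mul_same C).trace_nonneg).1
  have h4 : 0 ≤ ((W * C - D)ᴴ * (W * C - D)).trace.re :=
    (Complex.nonneg_iff.mp (posSemidef_conjTranspose_mul_self _).trace_nonneg).1
  have e1 : (Dᴴ * (W * C)).trace.re = (W * A).trace.re := by
    rw [Matrix.trace_mul_comm, Matrix.mul_assoc, ← hCD]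
  have e2 : ((W * C)ᴴ * D).trace.re = (W * A).trace.re := by
    rw [← e1, ← conjTranspose_conjTranspose D, ← conjTranspose_mul, trace_conjTranspose]
    simp
  have e3 : Cᴴ * (1 - Wᴴ * W) * C = Cᴴ * C - (W * C)ᴴ * (W * C) := by
    rw [conjTranspose_mul W C, Matrix.mul_sub, Matrix.sub_mul]
    simp only [Matrix.mul_assoc, Matrix.mul_one]
  have e4 : (W * C - D)ᴴ * (W * C - D) =
      (W * C)ᴴ * (W * C) - (W * C)ᴴ * D - Dᴴ * (W * C) + Dᴴ * D := by
    rw [conjTranspose_sub, Matrix.sub_mul, Matrix.mul_sub,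
      Matrix.mul_sub]; abel
  rw [e3, trace_sub, Complex.sub_re] at h3
  rw [e4, trace_add, trace_sub, trace_sub, Complex.add_re, Complex.sub_re, Complex.sub_re] at h4
  linarith

/-- The adjoint of a contraction is a contraction: both conditions are Schur complements of the block
matrix with blocks `1`, `P`, `Pᴴ`, `1`. -/
theorem posSemidef_one_sub_mul_conjTranspose {m n : Type*} [Fintype m] [Fintype n] [DecidableEq m]
    [DecidableEq n] {P : Matrix m n ℂ}
    (hP : (1 - Pᴴ * P).PosSemidef) :
    (1 - P * Pᴴ).PosSemidef := by
  let _ : Invertible (1 : Matrix m m ℂ) := invertibleOne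
  let _ : Invertible (1 : Matrix n n ℂ) := invertibleOne
  have h1 := (PosDef.fromBlocks₁₁ (A := (1 : Matrix m m ℂ)) P (1 : Matrix n n ℂ) PosDef.one).mpr
    (by simpa using hP)
  have h2 := (PosDef.fromBlocks₂₂ (1 : Matrix m m ℂ) P (D := (1 : Matrix n n ℂ)) PosDef.one).mp h1
  simpa using h2

theorem traceNorm_smul {m n : Type*} [Fintype m] [Fintype n] [DecidableEq n] (c : ℝ) (hc : 0 ≤ c)
    (A : Matrix m n ℂ) : traceNorm ((c : ℂ) • A) = c * traceNorm A := by
  have hpos := posSemidef_conjTranspose_mul_self A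
  have : CFC.sqrt (((c : ℂ) • A)ᴴ * ((c : ℂ) • A)) = (c : ℂ) • CFC.sqrt (Aᴴ * A) := by
    apply CFC.sqrt_unique
    · rw [smul_mul_smul_comm, CFC.sqrt_mul_sqrt_self _ hpos.nonneg, conjTranspose_smul,
        Matrix.smul_mul, Matrix.mul_smul, smul_smul]
      simp
    · exact ((nonneg_iff_posSemidef.mp (CFC.sqrt_nonneg _)).smul (by simpa using hc)).nonneg
  rw [traceNorm, this, trace_smul, traceNorm]
  simp

theorem continuous_traceNorm {m n : Type*} [Fintype m] [Fintype n] [DecidableEq n] :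
    Continuous (traceNorm : Matrix m n ℂ → ℝ) := by
  open scoped Matrix.Norms.L2Operator in
  have h : Continuous fun A : Matrix m n ℂ => CFC.sqrt (Aᴴ * A) :=
    CFC.continuousOn_sqrt.comp_continuous (by fun_prop)
      (fun A => (posSemidef_conjTranspose_mul_self A).nonneg)
  unfold traceNorm
  fun_prop

theorem exists_contraction_trace_mul_eq {m n : Type*} [Fintype m] [Fintype n] [DecidableEq m]
    [DecidableEq n] (A : Matrix m n ℂ) :
    ∃ B : Matrix n m ℂ, (1 - Bᴴ * B).PosSemidef ∧ (1 - B * Bᴴ).PosSemidef ∧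
      (B * A).trace = traceNorm A := by
  obtain ⟨P, S, hS, hA, hPA, hP, htr⟩ := exists_polar A
  refine ⟨Pᴴ, ?_, ?_, by rw [hPA, htr]⟩
  · rw [conjTranspose_conjTranspose]
    exact posSemidef_one_sub_mul_conjTranspose hP
  · rwa [conjTranspose_conjTranspose]

theorem traceNorm_submatrix {m n : Type*} [Fintype m] [Fintype n] [DecidableEq m]
    [DecidableEq n] (A : Matrix m m ℂ) (e : n ≃ m) :
    traceNorm (A.submatrix e e) = traceNorm A := by
  rw [traceNorm_eq_sum_roots, traceNorm_eq_sum_roots, conjTranspose_submatrix,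
    submatrix_mul_equiv]
  have := charpoly_reindex e.symm (Aᴴ * A)
  rw [reindex_apply, Equiv.symm_symm] at this
  rw [this]

/-! ### Trace norms of partial traces and of block operators -/

/-- Tracing out a tensor factor does not increase the trace norm. -/
theorem traceNorm_partialTrace_le {m r : Type*} [Fintype m] [Fintype r] [DecidableEq m]
    [DecidableEq r] (A : Matrix (m × r) (m × r) ℂ) :
    traceNorm (Matrix.of fun i j => ∑ k, A (i, k) (j, k)) ≤ traceNorm A := by
  obtain ⟨B, hB, -, htr⟩ := exists_contraction_trace_mul_eq
    (Matrix.of fun i j => ∑ k, A (i, k) (j, k))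
  have hW : (1 - (B ⊗ₖ (1 : Matrix r r ℂ))ᴴ * (B ⊗ₖ (1 : Matrix r r ℂ))).PosSemidef := by
    have : 1 - (B ⊗ₖ (1 : Matrix r r ℂ))ᴴ * (B ⊗ₖ (1 : Matrix r r ℂ)) =
        (1 - Bᴴ * B) ⊗ₖ (1 : Matrix r r ℂ) := by
      rw [conjTranspose_kronecker, ← mul_kronecker_mul, conjTranspose_one, Matrix.mul_one,
        sub_eq_iff_eq_add, ← add_kronecker, sub_add_cancel, one_kronecker_one]
    rw [this]
    exact hB.kronecker PosSemidef.one
  have h := re_trace_mul_le_traceNorm hW A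
  have e : ((B ⊗ₖ (1 : Matrix r r ℂ)) * A).trace = traceNorm
      (Matrix.of fun i j => ∑ k, A (i, k) (j, k)) := by
    rw [← htr]
    simp only [Matrix.trace, diag_apply, Matrix.mul_apply, Fintype.sum_prod_type,
      kroneckerMap_apply, Matrix.one_apply, of_apply, Finset.mul_sum]
    refine Finset.sum_congr rfl fun i _ => ?_
    rw [Finset.sum_comm]
    refine Finset.sum_congr rfl fun j _ => ?_
    refine Finset.sum_congr rfl fun k _ => ?_
    simp
  rwa [e, Complex.ofReal_re] at h

/-- Pairing with the contraction with off-diagonal blocks `Bᴴ` and `B`, where `B` is optimal for `N`. -/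
theorem two_mul_traceNorm_le_fromBlocks {m : Type*} [Fintype m] [DecidableEq m]
    (X N Y : Matrix m m ℂ) :
    2 * traceNorm N ≤ traceNorm (fromBlocks X N Nᴴ Y) := by
  obtain ⟨B, hB, hB', htr⟩ := exists_contraction_trace_mul_eq N
  have hW : (1 - (fromBlocks 0 Bᴴ B 0)ᴴ * fromBlocks 0 Bᴴ B 0).PosSemidef := by
    have : 1 - (fromBlocks 0 Bᴴ B 0)ᴴ * fromBlocks 0 Bᴴ B 0 =
        fromBlocks (1 - Bᴴ * B) 0 0 (1 - B * Bᴴ) := by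
      rw [fromBlocks_conjTranspose, fromBlocks_multiply, ← fromBlocks_one]
      rw [sub_eq_iff_eq_add, fromBlocks_add]
      simp
    rw [this]
    obtain ⟨E, hE⟩ := CStarAlgebra.nonneg_iff_eq_star_mul_self.mp hB.nonneg
    obtain ⟨F, hF⟩ := CStarAlgebra.nonneg_iff_eq_star_mul_self.mp hB'.nonneg
    have : fromBlocks (1 - Bᴴ * B) 0 0 (1 - B * Bᴴ) =
        (fromBlocks E 0 0 F)ᴴ * fromBlocks E 0 0 F := by
      rw [hE, hF, fromBlocks_conjTranspose, fromBlocks_multiply]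
      simp [star_eq_conjTranspose]
    rw [this]
    exact posSemidef_conjTranspose_mul_self _
  have h := re_trace_mul_le_traceNorm hW (fromBlocks X N Nᴴ Y)
  rw [fromBlocks_multiply, Matrix.trace, Fintype.sum_sum_type] at h
  simp only [diag_apply, fromBlocks_apply₁₁, fromBlocks_apply₂₂] at h
  change ((0 * X + Bᴴ * Nᴴ).trace + (B * N + 0 * Y).trace).re ≤ _ at h
  rw [Complex.add_re] at h
  have e2 : (Bᴴ * Nᴴ).trace.re = traceNorm N := by
    rw [← conjTranspose_mul, trace_conjTranspose, Matrix.trace_mul_comm, htr]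
    simp
  simp only [Matrix.zero_mul, zero_add, add_zero, htr, e2, Complex.ofReal_re] at h
  linarith

/-! ### Lowering the rank of a state under linear constraints -/

section Reduction

variable {E : Type*} [AddCommGroup E] [Module ℂ E]

/-- Hermitian elements in the kernel of a linear map that respects adjoints, by counting complex
dimensions. -/
theorem exists_isHermitian_ne_zero_of_finrank_lt {n : Type*} [Fintype n]
    [FiniteDimensional ℂ E] (L : Matrix n n ℂ →ₗ[ℂ] E) (hL : ∀ X, L X = 0 → L Xᴴ = 0)
    (hn : Module.finrank ℂ E < Fintype.card n ^ 2) :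
    ∃ H : Matrix n n ℂ, H.IsHermitian ∧ H ≠ 0 ∧ L H = 0 := by
  have hker : LinearMap.ker L ≠ ⊥ := by
    apply LinearMap.ker_ne_bot_of_finrank_lt
    rwa [Module.finrank_matrix, Module.finrank_self, mul_one, ← sq]
  obtain ⟨X, hX, hX0⟩ := Submodule.exists_mem_ne_zero_of_ne_bot hker
  rw [LinearMap.mem_ker] at hX
  by_cases h : X + Xᴴ = 0
  · refine ⟨Complex.I • X, ?_, by simpa using hX0, by simp [hX]⟩
    rw [IsHermitian, conjTranspose_smul, ← neg_eq_of_add_eq_zero_right h]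
    simp
  · refine ⟨X + Xᴴ, isHermitian_add_transpose_self X, h, by simp [hX, hL X hX]⟩

/-- The line through `1` in the direction of `H` meets the boundary of the positive cone, in an
operator that is not of full rank. -/
theorem exists_one_add_smul_eq_conjTranspose_mul_self {n : ℕ}
    {H : Matrix (Fin (n + 1)) (Fin (n + 1)) ℂ}
    (hH : H.IsHermitian) (h0 : H ≠ 0) :
    ∃ (t : ℂ) (C : Matrix (Fin n) (Fin (n + 1)) ℂ), 1 + t • H = Cᴴ * C := by
  obtain ⟨i₀, -, hmax⟩ := Finset.exists_max_image Finset.univ (fun i => |hH.eigenvalues i|)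
    Finset.univ_nonempty
  set μ := hH.eigenvalues with hμ
  have hi₀ : μ i₀ ≠ 0 := by
    intro h
    apply h0
    rw [← hH.eigenvalues_eq_zero_iff]
    ext i
    have := hmax i (Finset.mem_univ i)
    simp only [h, abs_zero] at this
    simpa using this
  have hnn : ∀ i, 0 ≤ 1 - μ i / μ i₀ := by
    intro i
    have h1 : |μ i / μ i₀| ≤ 1 := by
      rw [abs_div]
      exact div_le_one_of_le₀ (hmax i (Finset.mem_univ i)) (abs_nonneg _)
    linarith [le_abs_self (μ i / μ i₀)]
  obtain ⟨Q, hQ⟩ : ∃ Q : Matrix (Fin (n + 1)) (Fin (n + 1)) ℂ, Q = hH.eigenvectorUnitary := ⟨_, rfl⟩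
  have hQQ : Q * Qᴴ = 1 := hQ ▸ Unitary.coe_mul_star_self _
  have hsp : H = Q * diagonal (fun i => (μ i : ℂ)) * Qᴴ := by
    have h := hH.spectral_theorem
    rw [Unitary.conjStarAlgAut_apply, ← hQ] at h
    exact h
  set D : Matrix (Fin (n + 1)) (Fin (n + 1)) ℂ :=
    diagonal (fun i => ((√(1 - μ i / μ i₀) : ℝ) : ℂ)) * Qᴴ with hD
  -- The operator `1 - H / μ i₀` is `Dᴴ * D`, and the row `i₀` of `D` vanishes.
  refine ⟨((-(μ i₀)⁻¹ : ℝ) : ℂ), D.submatrix i₀.succAbove id, ?_⟩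
  have hDD : 1 + ((-(μ i₀)⁻¹ : ℝ) : ℂ) • H = Dᴴ * D := by
    rw [hD, conjTranspose_mul, conjTranspose_conjTranspose, diagonal_conjTranspose,
      Matrix.mul_assoc, ← Matrix.mul_assoc (diagonal _), diagonal_mul_diagonal, ← Matrix.mul_assoc]
    rw [← hQQ]
    nth_rw 1 [hsp]
    rw [← Matrix.smul_mul, ← Matrix.mul_smul, ← Matrix.add_mul]
    nth_rw 1 [← Matrix.mul_one Q]
    rw [← Matrix.mul_add]
    congr 2
    rw [← diagonal_one, ← diagonal_smul, diagonal_add]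
    congr
    ext i
    simp only [Pi.star_apply, RCLike.star_def, Complex.conj_ofReal, Pi.smul_apply, smul_eq_mul]
    rw [← Complex.ofReal_mul, ← Complex.ofReal_mul, Real.mul_self_sqrt (hnn i)]
    push_cast
    ring
  have hrow : ∀ j, D i₀ j = 0 := by
    intro j
    rw [hD, diagonal_mul, div_self hi₀]
    simp
  rw [hDD]
  ext i j
  simp [Matrix.mul_apply, Fin.sum_univ_succAbove _ i₀, hrow]

/-- A state `Vᴴ * V` can be replaced by one of rank at most `card w` without changing its image under
`L`, if `L` takes values in a space of dimension less than `(card w + 1) ^ 2`: as long as the rank is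
larger, there is a Hermitian direction along which `L` is constant, and moving in it to the boundary
of the positive cone lowers the rank. -/
theorem exists_conjTranspose_mul_self_of_finrank_lt {x : Type*} [FiniteDimensional ℂ E]
    {w : Type*} [Fintype w] [DecidableEq w] (L : Matrix x x ℂ →ₗ[ℂ] E) (hL : ∀ X, L X = 0 → L Xᴴ = 0)
    (hw : Module.finrank ℂ E < (Fintype.card w + 1) ^ 2) (n : ℕ) (V : Matrix (Fin n) x ℂ) :
    ∃ V' : Matrix w x ℂ, L (V'ᴴ * V') = L (Vᴴ * V) := by
  induction n with
  | zero => exact ⟨0, by simp⟩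
  | succ n ih =>
    by_cases hn : n + 1 ≤ Fintype.card w
    · obtain ⟨f⟩ := Function.Embedding.nonempty_of_card_le (α := Fin (n + 1)) (β := w) (by simpa)
      -- `J` is the isometry of coordinate spaces induced by `f`.
      set J : Matrix w (Fin (n + 1)) ℂ := Matrix.of fun j i => if f i = j then 1 else 0 with hJ
      have hJJ : Jᴴ * J = 1 := by
        ext i j
        simp [hJ, Matrix.mul_apply, Matrix.one_apply, eq_comm]
      refine ⟨J * V, ?_⟩
      rw [conjTranspose_mul, Matrix.mul_assoc, ← Matrix.mul_assoc Jᴴ, hJJ, Matrix.one_mul]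
    · -- There are more than `card w` rows: one of them can be removed.
      let L' : Matrix (Fin (n + 1)) (Fin (n + 1)) ℂ →ₗ[ℂ] E :=
        { toFun := fun X => L (Vᴴ * X * V)
          map_add' := fun X Y => by rw [Matrix.mul_add, Matrix.add_mul, map_add]
          map_smul' := fun c X => by simp }
      obtain ⟨H, hH, hH0, hLH⟩ := exists_isHermitian_ne_zero_of_finrank_lt L'
        (fun X hX => by
          have := hL _ hX
          rwa [conjTranspose_mul, conjTranspose_mul, conjTranspose_conjTranspose,
            ← Matrix.mul_assoc] at this)
        (by
          refine hw.trans_le ?_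
          rw [Fintype.card_fin]
          exact Nat.pow_le_pow_left (by omega) 2)
      obtain ⟨t, C, hC⟩ := exists_one_add_smul_eq_conjTranspose_mul_self hH hH0
      obtain ⟨V', hV'⟩ := ih (C * V)
      refine ⟨V', ?_⟩
      rw [hV', conjTranspose_mul, Matrix.mul_assoc, ← Matrix.mul_assoc Cᴴ, ← hC, Matrix.add_mul,
        Matrix.mul_add, map_add, Matrix.one_mul, Matrix.smul_mul, Matrix.mul_smul, map_smul,
        ← Matrix.mul_assoc]
      change _ + t • L' H = _
      rw [hLH, smul_zero, add_zero]

end Reduction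

/-! ### Choi matrices and images of pure states -/

theorem exists_rank_factorization {m n : Type*} [Fintype m] [Fintype n] [DecidableEq n]
    (A : Matrix m n ℂ) :
    ∃ (P : Matrix m (Fin A.rank) ℂ) (Q : Matrix (Fin A.rank) n ℂ), A = P * Q := by
  let b : Module.Basis (Fin A.rank) ℂ (LinearMap.range A.mulVecLin) :=
    Module.finBasisOfFinrankEq ℂ _ rfl
  refine ⟨Matrix.of fun i l => (b l : m → ℂ) i,
    Matrix.of fun l j => b.repr ⟨A.mulVecLin (Pi.single j 1), LinearMap.mem_range_self _ _⟩ l, ?_⟩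
  ext i j
  have h := congrArg (fun v : LinearMap.range A.mulVecLin => (v : m → ℂ) i)
    (b.sum_repr ⟨A.mulVecLin (Pi.single j 1), LinearMap.mem_range_self _ _⟩)
  have hA : A i j = A.mulVecLin (Pi.single j 1) i := by simp
  refine (hA.trans h.symm).trans ?_
  rw [Matrix.mul_apply]
  simp only [Submodule.coe_sum, Submodule.coe_smul, Finset.sum_apply, Pi.smul_apply, smul_eq_mul,
    of_apply]
  exact Finset.sum_congr rfl fun l _ => mul_comm _ _

theorem choi_apply {x y : Type*} [Fintype x] [DecidableEq x] (Φ : SuperOp x y) (p q : y)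
    (a b : x) : choi Φ (p, a) (q, b) = Φ (Matrix.single a b 1) p q := by
  simp only [choi, Matrix.sum_apply, kroneckerMap_apply, Matrix.single_apply]
  rw [Finset.sum_eq_single a, Finset.sum_eq_single b] <;> simp +contextual

theorem apply_eq_sum_choi {x y : Type*} [Fintype x] [DecidableEq x] (Φ : SuperOp x y)
    (X : Matrix x x ℂ) (p q : y) :
    Φ X p q = ∑ a, ∑ b, X a b * choi Φ (p, a) (q, b) := by
  conv_lhs => rw [matrix_eq_sum_single X]
  simp only [map_sum, Matrix.sum_apply, choi_apply]
  refine Finset.sum_congr rfl fun a _ => Finset.sum_congr rfl fun b _ => ?_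
  have : Matrix.single a b (X a b) = X a b • Matrix.single a b (1 : ℂ) := by simp
  rw [this, map_smul, Matrix.smul_apply, smul_eq_mul]

/-- The vector of `ℂ^x ⊗ ℂ^z` whose coordinates are the entries of `V`. The rows of `V` are indexed by
the auxiliary factor, so that `Vᴴ * V` is the transpose of the reduced state on `ℂ^x`. -/
def vecOf {x z : Type*} (V : Matrix z x ℂ) : EuclideanSpace ℂ (x × z) :=
  WithLp.toLp 2 fun p => V p.2 p.1

theorem vecOf_surjective {x z : Type*} :
    Function.Surjective (vecOf : Matrix z x ℂ → EuclideanSpace ℂ (x × z)) :=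
  fun u => ⟨Matrix.of fun c a => u (a, c), rfl⟩

theorem trace_outer {n : Type*} [Fintype n] (u : EuclideanSpace ℂ n) :
    (outer u).trace = ((‖u‖ ^ 2 : ℝ) : ℂ) := by
  rw [EuclideanSpace.norm_sq_eq]
  simp [outer, Matrix.trace, vecMulVec_apply, Complex.mul_conj, Complex.normSq_eq_norm_sq]

theorem trace_outer_vecOf {x z : Type*} [Fintype x] [Fintype z] (V : Matrix z x ℂ) :
    (outer (vecOf V)).trace = (Vᴴ * V).trace := by
  simp [outer, vecOf, Matrix.trace, vecMulVec_apply, Matrix.mul_apply, Fintype.sum_prod_type,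
    mul_comm]

theorem tensorId_outer_vecOf {x y z : Type*} [Fintype x] [DecidableEq x] [Fintype y]
    [DecidableEq y] (Φ : SuperOp x y) (V : Matrix z x ℂ) :
    tensorId Φ z (outer (vecOf V)) =
      ((1 : Matrix y y ℂ) ⊗ₖ V) * choi Φ * ((1 : Matrix y y ℂ) ⊗ₖ V)ᴴ := by
  ext ⟨p, c⟩ ⟨q, d⟩
  simp only [tensorId, LinearMap.coe_mk, AddHom.coe_mk, Matrix.of_apply]
  rw [apply_eq_sum_choi]
  simp only [Matrix.mul_apply, Fintype.sum_prod_type, kroneckerMap_apply, conjTranspose_apply,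
    Matrix.one_apply, ite_mul, one_mul, zero_mul, Finset.sum_ite_eq, Finset.mem_univ, if_true,
    Finset.sum_ite_irrel, Finset.sum_const_zero, apply_ite star, star_zero, mul_ite, mul_zero,
    outer, vecOf, vecMulVec_apply, of_apply, Pi.star_apply]
  rw [Finset.sum_comm]
  refine Finset.sum_congr rfl fun b _ => ?_
  rw [Finset.sum_mul]
  refine Finset.sum_congr rfl fun a _ => ?_
  ring

theorem traceNorm_outer {n : Type*} [Fintype n] [DecidableEq n] (u : EuclideanSpace ℂ n) :
    traceNorm (outer u) = ‖u‖ ^ 2 := by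
  have h : (outer u).PosSemidef := posSemidef_vecMulVec_self_star _
  rw [traceNorm, h.isHermitian.eq, CFC.sqrt_mul_self _ h.nonneg, trace_outer, Complex.ofReal_re]

theorem outer_smul {n : Type*} (c : ℝ) (u : EuclideanSpace ℂ n) :
    outer (c • u) = ((c ^ 2 : ℝ) : ℂ) • outer u := by
  ext i j
  simp [outer, vecMulVec_apply]
  ring

/-! ### From arbitrary operators to pure states -/

/-- Positivity suffices, as the positive semidefinite operators span; complete positivity is used with
a one-dimensional auxiliary space. -/
theorem IsCompletelyPositive.map_conjTranspose {x y : Type*} [Fintype x] [DecidableEq x]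
    [Fintype y] {Φ : SuperOp x y}
    (h : IsCompletelyPositive Φ) (X : Matrix x x ℂ) : Φ Xᴴ = (Φ X)ᴴ := by
  have hpos : ∀ P : Matrix x x ℂ, P.PosSemidef → (Φ P).IsHermitian := by
    intro P hP
    have h1 := h 1 (P ⊗ₖ (1 : Matrix (Fin 1) (Fin 1) ℂ)) (hP.kronecker PosSemidef.one)
    rw [tensorId_kronecker] at h1
    have h2 := h1.isHermitian.submatrix (fun i : y => (i, (0 : Fin 1)))
    have e : (Φ P ⊗ₖ (1 : Matrix (Fin 1) (Fin 1) ℂ)).submatrix (fun i : y => (i, (0 : Fin 1)))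
        (fun i : y => (i, (0 : Fin 1))) = Φ P := by
      ext i j
      simp
    rwa [e] at h2
  have hX : X ∈ Submodule.span ℂ {P : Matrix x x ℂ | 0 ≤ P} := by
    open scoped Matrix.Norms.L2Operator in
    rw [CStarAlgebra.span_nonneg]
    trivial
  induction hX using Submodule.span_induction with
  | mem P hP =>
    have hP' : P.PosSemidef := nonneg_iff_posSemidef.mp hP
    rw [hP'.isHermitian.eq, (hpos P hP').eq]
  | zero => simp
  | add X Y _ _ hX hY => rw [conjTranspose_add, map_add, map_add, conjTranspose_add, hX, hY]
  | smul c X _ hX => rw [conjTranspose_smul, map_smul, map_smul, conjTranspose_smul, hX]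

/-- Purification: the operator `F * Fᴴ` is a partial trace of a rank-one operator, and tracing out does
not increase the trace norm. -/
theorem exists_vec_traceNorm_tensorId_mul_conjTranspose_le {x y z r : Type*} [Fintype x]
    [Fintype y] [DecidableEq y] [Fintype z] [DecidableEq z] [Fintype r] [DecidableEq r]
    (Φ : SuperOp x y) (F : Matrix (x × z) r ℂ) :
    ∃ u : EuclideanSpace ℂ (x × (z × r)), ((‖u‖ ^ 2 : ℝ) : ℂ) = (F * Fᴴ).trace ∧
      traceNorm (tensorId Φ z (F * Fᴴ)) ≤ traceNorm (tensorId Φ (z × r) (outer u)) := by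
  refine ⟨WithLp.toLp 2 fun s => F (s.1, s.2.1) s.2.2, ?_, ?_⟩
  · rw [← trace_outer]
    simp [Matrix.trace, Matrix.mul_apply, outer, vecMulVec_apply, Fintype.sum_prod_type]
  · set M := tensorId Φ (z × r) (outer (WithLp.toLp 2 fun s => F (s.1, s.2.1) s.2.2)) with hM
    have h := traceNorm_partialTrace_le
      (M.submatrix (Equiv.prodAssoc y z r) (Equiv.prodAssoc y z r))
    rw [traceNorm_submatrix] at h
    convert h using 2
    ext ⟨p, c⟩ ⟨q, d⟩
    simp only [hM, tensorId, LinearMap.coe_mk, AddHom.coe_mk, Matrix.of_apply, submatrix_apply,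
      Equiv.prodAssoc_apply, ← Matrix.sum_apply, ← map_sum]
    refine congrFun (congrFun (congrArg Φ ?_) p) q
    ext i j
    simp [Matrix.mul_apply, Matrix.sum_apply, outer, vecMulVec_apply]

/-- For maps that preserve adjoints, arbitrary operators do no better than pure states with a larger
auxiliary space. If `A = C * Dᴴ` is an optimal factorization, then half the positive block operator
with blocks `C * Cᴴ`, `A`, `Aᴴ`, `D * Dᴴ` has trace `‖A‖₁`, and its image has the image of `A` and
its adjoint off the diagonal. The vector is a purification of this operator. -/
theorem exists_vec_traceNorm_tensorId_le {x y z : Type*} [Fintype x] [Fintype y] [DecidableEq x]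
    [DecidableEq y] [Fintype z] [DecidableEq z] (Φ : SuperOp x y) (hΦ : ∀ X, Φ Xᴴ = (Φ X)ᴴ)
    (A : Matrix (x × z) (x × z) ℂ) :
    ∃ u : EuclideanSpace ℂ (x × ((z ⊕ z) × (x × z))), ‖u‖ ^ 2 = traceNorm A ∧
      traceNorm (tensorId Φ z A) ≤ traceNorm (tensorId Φ _ (outer u)) := by
  obtain ⟨C, D, hCD, hC, hD⟩ := exists_factorization A
  let s : ℂ := ((√2)⁻¹ : ℝ)
  have hs : s * star s = ((1 / 2 : ℝ) : ℂ) := by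
    simp only [s, RCLike.star_def, Complex.conj_ofReal]
    rw [← Complex.ofReal_mul, ← mul_inv, Real.mul_self_sqrt (by norm_num), one_div]
  let F : Matrix (x × (z ⊕ z)) (x × z) ℂ :=
    s • (fromRows C D).submatrix (Equiv.prodSumDistrib x z z) id
  have hF : F * Fᴴ = ((1 / 2 : ℝ) : ℂ) • (fromBlocks (C * Cᴴ) A Aᴴ (D * Dᴴ)).submatrix
      (Equiv.prodSumDistrib x z z) (Equiv.prodSumDistrib x z z) := by
    simp only [F]
    rw [conjTranspose_smul, Matrix.smul_mul, Matrix.mul_smul, smul_smul, hs, hCD]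
    congr 1
    ext ⟨i, c | c⟩ ⟨j, d | d⟩ <;> simp [Matrix.mul_apply]
  obtain ⟨u, hu, hle⟩ := exists_vec_traceNorm_tensorId_mul_conjTranspose_le Φ F
  refine ⟨u, ?_, ?_⟩
  · rw [← Complex.ofReal_inj, hu, hF, trace_smul, Matrix.trace]
    simp only [diag_apply, submatrix_apply]
    rw [Equiv.sum_comp (Equiv.prodSumDistrib x z z)
      (fun i => fromBlocks (C * Cᴴ) A Aᴴ (D * Dᴴ) i i), Fintype.sum_sum_type]
    change _ • ((C * Cᴴ).trace + (D * Dᴴ).trace) = _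
    rw [Matrix.trace_mul_comm C, Matrix.trace_mul_comm D, hC, hD, smul_eq_mul]
    push_cast
    ring
  · refine le_trans ?_ hle
    have hΦF : tensorId Φ (z ⊕ z) (F * Fᴴ) =
        ((1 / 2 : ℝ) : ℂ) • (fromBlocks (tensorId Φ z (C * Cᴴ)) (tensorId Φ z A) (tensorId Φ z A)ᴴ
          (tensorId Φ z (D * Dᴴ))).submatrix (Equiv.prodSumDistrib y z z)
            (Equiv.prodSumDistrib y z z) := by
      rw [hF, map_smul]
      congr 1
      ext ⟨p, c | c⟩ ⟨q, d | d⟩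
      · rfl
      · rfl
      · exact congrFun (congrFun (hΦ (Matrix.of fun i j => A (i, d) (j, c))) p) q
      · rfl
    rw [hΦF, traceNorm_smul _ (by norm_num), traceNorm_submatrix]
    linarith [two_mul_traceNorm_le_fromBlocks (tensorId Φ z (C * Cᴴ)) (tensorId Φ z A)
      (tensorId Φ z (D * Dᴴ))]

/-! ### Changing the auxiliary space of a pure state -/

/-- The linear map `ρ ↦ P* (1 ⊗ ρ) P`. For `ρ = Vᴴ * V` its value is the Gram matrix of the columns of
`(1 ⊗ V) P`. -/
noncomputable def gramMap {x y k : Type*} [Fintype x] [Fintype y] [DecidableEq y]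
    (P : Matrix (y × x) k ℂ) : Matrix x x ℂ →ₗ[ℂ] Matrix k k ℂ where
  toFun ρ := Pᴴ * ((1 : Matrix y y ℂ) ⊗ₖ ρ) * P
  map_add' ρ σ := by rw [kronecker_add, Matrix.mul_add, Matrix.add_mul]
  map_smul' c ρ := by rw [kronecker_smul, Matrix.mul_smul, Matrix.smul_mul]; rfl

theorem gramMap_conjTranspose {x y k : Type*} [Fintype x] [Fintype y] [DecidableEq y]
    (P : Matrix (y × x) k ℂ) (ρ : Matrix x x ℂ) : gramMap P ρᴴ = (gramMap P ρ)ᴴ := by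
  simp only [gramMap, LinearMap.coe_mk, AddHom.coe_mk, conjTranspose_mul,
    conjTranspose_conjTranspose, conjTranspose_kronecker, conjTranspose_one, Matrix.mul_assoc]

theorem gramMap_conjTranspose_mul_self {x y z k : Type*} [Fintype x] [Fintype y] [DecidableEq y]
    [Fintype z] (P : Matrix (y × x) k ℂ) (V : Matrix z x ℂ) :
    gramMap P (Vᴴ * V) =
      (((1 : Matrix y y ℂ) ⊗ₖ V) * P)ᴴ * (((1 : Matrix y y ℂ) ⊗ₖ V) * P) := by
  have h : (1 : Matrix y y ℂ) ⊗ₖ (Vᴴ * V) =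
      ((1 : Matrix y y ℂ) ⊗ₖ V)ᴴ * ((1 : Matrix y y ℂ) ⊗ₖ V) := by
    rw [conjTranspose_kronecker, conjTranspose_one, ← mul_kronecker_mul, Matrix.one_mul]
  simp only [gramMap, LinearMap.coe_mk, AddHom.coe_mk, h, conjTranspose_mul, Matrix.mul_assoc]

theorem tensorId_outer_vecOf_of_choi_eq {x y z k : Type*} [Fintype x] [DecidableEq x] [Fintype y]
    [DecidableEq y] [Fintype k] {Φ : SuperOp x y} {P Q : Matrix (y × x) k ℂ}
    (hPQ : choi Φ = P * Qᴴ) (V : Matrix z x ℂ) :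
    tensorId Φ z (outer (vecOf V)) =
      (((1 : Matrix y y ℂ) ⊗ₖ V) * P) * (((1 : Matrix y y ℂ) ⊗ₖ V) * Q)ᴴ := by
  rw [tensorId_outer_vecOf, hPQ, conjTranspose_mul]
  simp only [Matrix.mul_assoc]

/-- If `choi Φ = P * Qᴴ`, the trace norm of the image of a pure state is determined by the values of
`gramMap P` and `gramMap Q` at its reduced state. -/
theorem traceNorm_tensorId_outer_congr {x y z z' k : Type*} [Fintype x] [DecidableEq x] [Fintype y]
    [DecidableEq y] [Fintype z] [DecidableEq z] [Fintype z'] [DecidableEq z'] [Fintype k]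
    [DecidableEq k] {Φ : SuperOp x y} {P Q : Matrix (y × x) k ℂ} (hPQ : choi Φ = P * Qᴴ)
    {V : Matrix z x ℂ} {V' : Matrix z' x ℂ} (hP : gramMap P (Vᴴ * V) = gramMap P (V'ᴴ * V'))
    (hQ : gramMap Q (Vᴴ * V) = gramMap Q (V'ᴴ * V')) :
    traceNorm (tensorId Φ z (outer (vecOf V))) = traceNorm (tensorId Φ z' (outer (vecOf V'))) := by
  rw [gramMap_conjTranspose_mul_self, gramMap_conjTranspose_mul_self] at hP hQ
  rw [tensorId_outer_vecOf_of_choi_eq hPQ, tensorId_outer_vecOf_of_choi_eq hPQ,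
    traceNorm_mul_conjTranspose, traceNorm_mul_conjTranspose, hP, hQ]

/-- The auxiliary space of a pure input can be replaced by any space of dimension at least twice the
rank of the Choi matrix. -/
theorem exists_vec_of_two_mul_rank_le {x y z w : Type*} [Fintype x] [DecidableEq x] [Fintype y]
    [DecidableEq y] [Fintype z] [DecidableEq z] [Fintype w] [DecidableEq w] [Nonempty w]
    (Φ : SuperOp x y) (hw : 2 * (choi Φ).rank ≤ Fintype.card w) (u : EuclideanSpace ℂ (x × z)) :
    ∃ u' : EuclideanSpace ℂ (x × w), ‖u'‖ ^ 2 = ‖u‖ ^ 2 ∧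
      traceNorm (tensorId Φ w (outer u')) = traceNorm (tensorId Φ z (outer u)) := by
  obtain ⟨P, Q, hPQ⟩ := exists_rank_factorization (choi Φ)
  rw [← conjTranspose_conjTranspose Q] at hPQ
  obtain ⟨V, rfl⟩ := vecOf_surjective u
  let L := (gramMap P).prod ((gramMap Qᴴ).prod (Matrix.traceLinearMap x ℂ ℂ))
  have hL : ∀ X, L X = 0 → L Xᴴ = 0 := by
    intro X hX
    simp only [L, LinearMap.prod_apply, Function.prod, Prod.mk_eq_zero, gramMap_conjTranspose,
      traceLinearMap_apply, trace_conjTranspose] at hX ⊢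
    simp [hX]
  have hdim : Module.finrank ℂ (Matrix (Fin (choi Φ).rank) (Fin (choi Φ).rank) ℂ ×
      Matrix (Fin (choi Φ).rank) (Fin (choi Φ).rank) ℂ × ℂ) < (Fintype.card w + 1) ^ 2 := by
    rw [Module.finrank_prod, Module.finrank_prod, Module.finrank_matrix, Module.finrank_self,
      Fintype.card_fin]
    -- With `k` the rank, `2 * k ^ 2 + 1 < (card w + 1) ^ 2`; for `k = 0` this needs `w` non-empty.
    have := Fintype.card_pos (α := w)
    nlinarith
  let e := Fintype.equivFin z
  obtain ⟨V', hV'⟩ := exists_conjTranspose_mul_self_of_finrank_lt L hL hdim _ (V.submatrix e.symm id)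
  rw [conjTranspose_submatrix, submatrix_mul_equiv, submatrix_id_id] at hV'
  simp only [L, LinearMap.prod_apply, Function.prod, Prod.mk.injEq, traceLinearMap_apply] at hV'
  refine ⟨vecOf V', ?_, traceNorm_tensorId_outer_congr hPQ hV'.1 hV'.2.1⟩
  rw [← Complex.ofReal_inj, ← trace_outer, ← trace_outer, trace_outer_vecOf, trace_outer_vecOf,
    hV'.2.2]

/-- An auxiliary space of the size of the input space suffices for every pure input, since any reduced
state on `ℂ^x` has a purification there. -/
theorem exists_vec_input_space {x y w : Type*} [Fintype x] [DecidableEq x] [Fintype y]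
    [DecidableEq y] [Fintype w] [DecidableEq w] (Φ : SuperOp x y) (u : EuclideanSpace ℂ (x × w)) :
    ∃ u' : EuclideanSpace ℂ (x × x), ‖u'‖ ^ 2 = ‖u‖ ^ 2 ∧
      traceNorm (tensorId Φ x (outer u')) = traceNorm (tensorId Φ w (outer u)) := by
  obtain ⟨P, Q, hPQ⟩ := exists_rank_factorization (choi Φ)
  rw [← conjTranspose_conjTranspose Q] at hPQ
  obtain ⟨V, rfl⟩ := vecOf_surjective u
  obtain ⟨R, hR⟩ := CStarAlgebra.nonneg_iff_eq_star_mul_self.mp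
    (posSemidef_conjTranspose_mul_self V).nonneg
  rw [star_eq_conjTranspose] at hR
  refine ⟨vecOf R, ?_, traceNorm_tensorId_outer_congr hPQ (by rw [hR]) (by rw [hR])⟩
  rw [← Complex.ofReal_inj, ← trace_outer, ← trace_outer, trace_outer_vecOf, trace_outer_vecOf, hR]

/-! ### The optimal input -/

theorem continuous_outer {n : Type*} :
    Continuous (outer : EuclideanSpace ℂ n → Matrix n n ℂ) := by
  unfold outer
  fun_prop

theorem exists_norm_eq_one_isMaxOn {x y w : Type*} [Fintype x] [Nonempty x]
    [Fintype y] [DecidableEq y] [Fintype w] [DecidableEq w] [Nonempty w] (Φ : SuperOp x y) :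
    ∃ u : EuclideanSpace ℂ (x × w), ‖u‖ = 1 ∧ ∀ v : EuclideanSpace ℂ (x × w), ‖v‖ ^ 2 ≤ 1 →
      traceNorm (tensorId Φ w (outer v)) ≤ traceNorm (tensorId Φ w (outer u)) := by
  classical
  have hcont : Continuous fun v : EuclideanSpace ℂ (x × w) =>
      traceNorm (tensorId Φ w (outer v)) :=
    continuous_traceNorm.comp ((LinearMap.continuous_of_finiteDimensional _).comp continuous_outer)
  obtain ⟨u, hu, hmax⟩ := (isCompact_sphere (0 : EuclideanSpace ℂ (x × w)) 1).exists_isMaxOn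
    (NormedSpace.sphere_nonempty.mpr zero_le_one) hcont.continuousOn
  rw [mem_sphere_zero_iff_norm] at hu
  refine ⟨u, hu, fun v hv => ?_⟩
  obtain ⟨v', hv', hvv'⟩ : ∃ v' : EuclideanSpace ℂ (x × w), ‖v'‖ = 1 ∧ v = ‖v‖ • v' := by
    by_cases h0 : v = 0
    · exact ⟨u, hu, by simp [h0]⟩
    · have hn : ‖v‖ ≠ 0 := norm_ne_zero_iff.mpr h0
      exact ⟨‖v‖⁻¹ • v, by rw [norm_smul, norm_inv, norm_norm, inv_mul_cancel₀ hn],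
        by rw [smul_smul, mul_inv_cancel₀ hn, one_smul]⟩
  have hle : traceNorm (tensorId Φ w (outer v')) ≤ traceNorm (tensorId Φ w (outer u)) :=
    hmax (by simpa using hv')
  rw [hvv', outer_smul, map_smul, traceNorm_smul _ (sq_nonneg _)]
  exact (mul_le_of_le_one_left (traceNorm_nonneg _) hv).trans hle

end QuantumOp

theorem theorem1 {x y w : Type*}
    [Fintype x] [DecidableEq x] [Nonempty x]
    [Fintype y] [DecidableEq y]
    [Fintype w] [DecidableEq w] [Nonempty w]
    (Φ₀ Φ₁ : QuantumOp.SuperOp x y)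
    (h₀ : QuantumOp.IsAdmissible Φ₀) (h₁ : QuantumOp.IsAdmissible Φ₁)
    (hw : 2 * (QuantumOp.choi (Φ₀ - Φ₁)).rank ≤ Fintype.card w) :
    ∃ u : EuclideanSpace ℂ (x × w), ‖u‖ = 1 ∧
      QuantumOp.traceNorm
          (QuantumOp.tensorId Φ₀ w (QuantumOp.outer u) -
            QuantumOp.tensorId Φ₁ w (QuantumOp.outer u)) =
        QuantumOp.diamondNorm (Φ₀ - Φ₁) := by
  open QuantumOp in
  obtain ⟨u, hu, hmax⟩ := exists_norm_eq_one_isMaxOn (w := w) (Φ₀ - Φ₁)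
  refine ⟨u, hu, ?_⟩
  have hsub : tensorId Φ₀ w (outer u) - tensorId Φ₁ w (outer u) =
      tensorId (Φ₀ - Φ₁) w (outer u) := rfl
  have hherm : ∀ X, (Φ₀ - Φ₁) Xᴴ = ((Φ₀ - Φ₁) X)ᴴ := fun X => by
    rw [LinearMap.sub_apply, LinearMap.sub_apply, h₀.1.map_conjTranspose,
      h₁.1.map_conjTranspose, Matrix.conjTranspose_sub]
  rw [hsub]
  symm
  -- The maximum over `ℂ^x ⊗ ℂ^w` is the greatest element of the set defining the diamond norm.
  refine IsGreatest.csSup_eq ⟨?_, ?_⟩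
  · obtain ⟨u', hu', he⟩ := exists_vec_input_space (Φ₀ - Φ₁) u
    exact ⟨outer u', by rw [traceNorm_outer, hu', hu, one_pow], he.symm⟩
  · rintro _ ⟨A, hA, rfl⟩
    obtain ⟨v, hv, hle⟩ := exists_vec_traceNorm_tensorId_le (Φ₀ - Φ₁) hherm A
    obtain ⟨v', hv', he⟩ := exists_vec_of_two_mul_rank_le (Φ₀ - Φ₁) hw v
    rw [← he] at hle
    exact hle.trans (hmax v' (by rwa [hv', hv]))
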